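/- **Setting.** Let $M\ge 2$ and let Type-I devices $D_1,\dots,D_M$ be located at points $\mathbf x_1,\dots,\mathbf x_M\in\mathbb R^2$ with $\mathbf x_{q-1}\neq\mathbf x_q$; put $l_q=|\mathbf x_{q-1}-\mathbf x_q|$ and $\ell(x)=\mathcal L(d_0/x)^{\epsilon}$ with $\mathcal L,d_0,\epsilon>0$. In slot $t\in\{1,\dots,M-1\}$ device $D_t$ transmits to $D_{t+1}$. The channel gains are $\phi_q=|h_q|^2\ell(l_q)$ with $h_q\sim\mathcal{CN}(0,1)$, $2\le q\le M$. The energy-harvesting indicators $I_q\in\{0,1\}$, $1\le q\le M$, are Bernoulli with $\Pr[I_q=1]=\rho_q$, and $\rho_1=0$; write $\rho_q^{[1]}=\rho_q$, $\rho_q^{[0]}=1-\rho_q$. The active Type-II devices in the disc of radius $r_t>0$ around $D_t$ form a homogeneous Poisson point process $\Phi_t$ of density $\lambda_t\ge 0$; put $\iota_t^{[0]}=\Pr[|\Phi_t|=0]=e^{-\lambda_t\pi r_t^2}$ and $\iota_t^{[1]}=1-\iota_t^{[0]}$. For every $t$ the variables $h_2,\dots,h_M$, $I_1,\dots,I_M$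 and the process $\Phi_t$ are mutually independent. Under the time-switching architecture with ratios $0\le\alpha_q<1$ and conversion efficiencies $0\le\eta_q\le 1$ ($2\le q\le M$), put $\Omega_q=\kappa\,\alpha_q\eta_q/(1-\alpha_q)$ with a constant $\kappa>0$. The transmission power $P_t$ of $D_t$ is the fixed power $P_0>0$ if $t=1$ or $I_t=0$, and $P_t=\Omega_t\phi_tP_{t-1}$ if $t\ge2$ and $I_t=1$. With noise power $\sigma^2>0$ let $\bar\gamma_0=P_0/\sigma^2$, let $X_{t+1}=P_t\phi_{t+1}/\sigma^2$ be the received SNR at $D_{t+1}$, and let $\bar F_{X_{t+1}}(x)=\Pr[X_{t+1}\ge x]$ for $x>0$. A share $p_M\in[0,1]$ of the power is allocated to the relayed signal. If $\Phi_t\ne\emptyset$, the remaining power serves Type-II devices: the nearest one with share $1-p_M$ in scheme TQoM, and $K_t$ of them with shares $p_{t,1},\dots,p_{t,K_t}\ge0$, $p_M+\sum_{k}p_{t,k}=1$, in scheme TCoM. Let $q_t$ be the total share of the Type-II signals, that is, $q_t=1-p_M$ in TQoM and $q_t=\sum_kp_{t,k}$ in TCoM. The rate at $D_{t+1}$ is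 $$\mathsf R_{t+1}=\frac{1-\alpha_{t+1}I_{t+1}}{M-1}\cdot\begin{cases}\log_2\!\Big(1+\dfrac{p_MP_t\phi_{t+1}}{q_tP_t\phi_{t+1}+\sigma^2}\Big)&\text{if }\Phi_t\neq\emptyset,\\[2mm]\log_2\!\Big(1+\dfrac{P_t\phi_{t+1}}{\sigma^2}\Big)&\text{if }\Phi_t=\emptyset,\end{cases}$$ and, for a target rate $R_M>0$, the outage probability is $\mathrm{OP}_{t+1}=\Pr[\mathsf R_{t+1}<R_M]$. **Theorem.** For every $t\in\{1,\dots,M-1\}$: 1. The outage probability at $D_{t+1}$ is the same in both schemes and equals $$\mathrm{OP}^{\mathrm{TQoM}}_{t+1}=\mathrm{OP}^{\mathrm{TCoM}}_{t+1}=1-\sum_{i=0}^1\sum_{j=0}^1\rho^{[i]}_{t+1}\,\iota^{[j]}_t\,\bar F_{X_{t+1}}\big(\tau_M^{[ij]}\big),$$ where $$\tau_M^{[00]}=2^{(M-1)R_M}-1,\qquad \tau_M^{[10]}=2^{\frac{M-1}{1-\alpha_{t+1}}R_M}-1,\qquad \tau_M^{[i1]}=\frac{\tau_M^{[i0]}}{1-(\tau_M^{[i0]}+1)(1-p_M)},$$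 and $\bar F_{X_{t+1}}(\tau_M^{[i1]})$ is read as $0$ when the denominator of $\tau_M^{[i1]}$ is not positive. 2. If $\alpha_q>0$ and $\eta_q>0$ for every $q\in\{2,\dots,t\}$ with $\rho_q>0$, then for every $x>0$ $$\bar F_{X_{t+1}}(x)=\rho_t^{[0]}\exp\!\Big(-\frac{x}{\bar\gamma_0\,\ell(l_{t+1})}\Big)+\sum_{\tau=1}^{t-1}\Big[\rho_\tau^{[0]}\prod_{j=\tau+1}^{t}\rho_j^{[1]}\Big]\,G^{t-\tau+1,0}_{0,t-\tau+1}\!\left[\frac{x}{\bar\gamma_0\,\ell(l_{t+1})\,\bar\xi_{\tau+1,t}}\,\middle|\,\underbrace{1,\dots,1}_{t-\tau},0\right],$$ where $\bar\xi_{a,b}=\prod_{i=a}^{b}\Omega_i\ell(l_i)$ and $G^{m,n}_{p,q}$ is the Meijer $G$-function (a summand with coefficient $0$ is read as $0$). -/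

import Mathlib

open MeasureTheory ProbabilityTheory

noncomputable section

/-! # Special functions and distributions -/

/-- The Mellin-Barnes integrand of the Meijer G-function `G^{m,n}_{p,q}[z | a ; b]`, with
`a = (a₁, …, a_p)` and `b = (b₁, …, b_q)`:
`∏_{j ≤ m} Γ(b_j - s) ∏_{j ≤ n} Γ(1 - a_j + s) / (∏_{j > m} Γ(1 - b_j + s) ∏_{j > n} Γ(a_j - s)) z^s`. -/
def meijerIntegrand (m n : ℕ) (a b : List ℂ) (z s : ℂ) : ℂ :=
  (((b.take m).map fun β => Complex.Gamma (β - s)).prod *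
      ((a.take n).map fun α => Complex.Gamma (1 - α + s)).prod) /
    (((b.drop m).map fun β => Complex.Gamma (1 - β + s)).prod *
      ((a.drop n).map fun α => Complex.Gamma (α - s)).prod) * z ^ s

/-- The vertical line `Re s = c` separates the poles of `Γ(b_j - s)`, `j ≤ m` (to its right), from
those of `Γ(1 - a_j + s)`, `j ≤ n` (to its left). -/
def MeijerSeparates (m n : ℕ) (a b : List ℂ) (c : ℝ) : Prop :=
  (∀ β ∈ b.take m, c < β.re) ∧ ∀ α ∈ a.take n, α.re - 1 < c

open Classical in
/-- The Meijer G-function `G^{m,n}_{p,q}[z | a ; b]` as the Mellin-Barnes integral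
`(1 / 2πi) ∫_L … ds` along a vertical line `L` separating the two families of poles.  Such a line
always exists when `n = 0`. -/
def meijerG (m n : ℕ) (a b : List ℂ) (z : ℂ) : ℂ :=
  if h : ∃ c : ℝ, MeijerSeparates m n a b c then
    (1 / (2 * (Real.pi : ℂ))) *
      ∫ y : ℝ, meijerIntegrand m n a b z ((h.choose : ℂ) + (y : ℂ) * Complex.I)
  else 0

/-- The circular complex Gaussian law `CN(0, 1)`: real and imaginary part are independent
`N(0, 1/2)` variables. -/
def complexGaussian : Measure ℂ :=
  ((gaussianReal 0 (1 / 2)).prod (gaussianReal 0 (1 / 2))).map fun u => (⟨u.1, u.2⟩ : ℂ)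

/-- The Euclidean plane. -/
abbrev Plane : Type := EuclideanSpace ℝ (Fin 2)

/-- `Φ` is a homogeneous Poisson point process of density `lam` on the region `C` of the plane. -/
structure IsHPPP {Ω : Type*} [MeasurableSpace Ω] (μ : Measure Ω) (Φ : Ω → Set Plane)
    (C : Set Plane) (lam : ℝ) : Prop where
  subset : ∀ ω, Φ ω ⊆ C
  measurable_count : ∀ B : Set Plane, MeasurableSet B → Measurable fun ω => (Φ ω ∩ B).encard
  law_count : ∀ B : Set Plane, MeasurableSet B → B ⊆ C → ∀ n : ℕ,
    μ.real {ω | (Φ ω ∩ B).encard = n} =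
      Real.exp (-(lam * volume.real B)) * (lam * volume.real B) ^ n / (n.factorial : ℝ)
  indep_count : ∀ (k : ℕ) (B : Fin k → Set Plane), (∀ i, MeasurableSet (B i)) →
    Pairwise (Function.onFun Disjoint B) → iIndepFun (fun i ω => (Φ ω ∩ B i).encard) μ

/-- The σ-algebra generated by a random point set: the one generated by its counts. -/
@[reducible] def pointSigma {Ω : Type*} (Φ : Ω → Set Plane) : MeasurableSpace Ω :=
  ⨆ (B : Set Plane) (_ : MeasurableSet B),
    MeasurableSpace.comap (fun ω => (Φ ω ∩ B).encard) inferInstance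

/-! # The network -/

/-- The deterministic parameters.  Type-I devices are numbered `1, …, M`, the hop of slot `t` goes
from device `t` to device `t + 1`, `1 ≤ t ≤ M - 1`; values at other indices are irrelevant. -/
structure Network where
  /-- number of Type-I devices -/
  M : ℕ
  /-- fixed transmission power -/
  P0 : ℝ
  /-- noise power `σ²` -/
  noise : ℝ
  /-- path-loss constant -/
  Lc : ℝ
  /-- reference distance -/
  d0 : ℝ
  /-- path-loss exponent -/
  ε : ℝ
  /-- share of the power allocated to the relayed signal `s_M` -/
  pM : ℝ
  /-- target rate of `s_M` -/
  RM : ℝ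
  /-- normalisation of the harvested power -/
  κ : ℝ
  /-- location of the Type-I device `q` -/
  pos : ℕ → Plane
  /-- radius of the coverage area of the Type-I device `t` -/
  r : ℕ → ℝ
  /-- density of the active Type-II devices around the Type-I device `t` -/
  lam : ℕ → ℝ
  /-- number of annuli of the coverage area in slot `t` (Type-II signals multiplexed by CoM) -/
  K : ℕ → ℕ
  /-- CoM: share of the power allocated in slot `t` to the signal of the `k`-th Type-II device -/
  p : ℕ → ℕ → ℝ
  /-- time-switching ratio of device `q` -/
  α : ℕ → ℝ
  /-- energy conversion efficiency of device `q` -/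
  η : ℕ → ℝ
  /-- probability that device `q` harvests energy -/
  ρ : ℕ → ℝ

/-- The admissible range of the parameters. -/
structure Network.Admissible (N : Network) : Prop where
  two_le_M : 2 ≤ N.M
  P0_pos : 0 < N.P0
  noise_pos : 0 < N.noise
  Lc_pos : 0 < N.Lc
  d0_pos : 0 < N.d0
  ε_pos : 0 < N.ε
  κ_pos : 0 < N.κ
  RM_pos : 0 < N.RM
  pM_mem : N.pM ∈ Set.Icc (0 : ℝ) 1
  pos_ne : ∀ q ∈ Finset.Icc 2 N.M, N.pos (q - 1) ≠ N.pos q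
  α_mem : ∀ q ∈ Finset.Icc 2 N.M, N.α q ∈ Set.Ico (0 : ℝ) 1
  η_mem : ∀ q ∈ Finset.Icc 2 N.M, N.η q ∈ Set.Icc (0 : ℝ) 1
  ρ_mem : ∀ q ∈ Finset.Icc 1 N.M, N.ρ q ∈ Set.Icc (0 : ℝ) 1
  /-- the first device never harvests energy -/
  ρ_one : N.ρ 1 = 0
  r_pos : ∀ t ∈ Finset.Icc 1 (N.M - 1), 0 < N.r t
  lam_nonneg : ∀ t ∈ Finset.Icc 1 (N.M - 1), 0 ≤ N.lam t
  p_nonneg : ∀ t ∈ Finset.Icc 1 (N.M - 1), ∀ k ∈ Finset.Icc 1 (N.K t), 0 ≤ N.p t k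
  /-- the whole power is allocated -/
  power_budget : ∀ t ∈ Finset.Icc 1 (N.M - 1), N.pM + ∑ k ∈ Finset.Icc 1 (N.K t), N.p t k = 1

namespace Network

variable (N : Network)

/-- Path loss at distance `x`. -/
def pathLoss (x : ℝ) : ℝ := N.Lc * (N.d0 / x) ^ N.ε

/-- Distance from device `q - 1` to device `q`. -/
def hopLength (q : ℕ) : ℝ := dist (N.pos (q - 1)) (N.pos q)

/-- Mean of the channel gain from device `q - 1` to device `q`. -/
def meanGain (q : ℕ) : ℝ := N.pathLoss (N.hopLength q)

/-- The factor `Ω_q` of the harvested power (time switching). -/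
def harvestFactor (q : ℕ) : ℝ := N.κ * N.α q * N.η q / (1 - N.α q)

/-- Ratio `P_0 / σ²`. -/
def γ0 : ℝ := N.P0 / N.noise

/-- Coverage area of device `t`. -/
def coverage (t : ℕ) : Set Plane := Metric.closedBall (N.pos t) (N.r t)

/-- `ρ_q^{[1]} = ρ_q` and `ρ_q^{[0]} = 1 - ρ_q`. -/
def rhoCoef (i : Fin 2) (q : ℕ) : ℝ := if i = 1 then N.ρ q else 1 - N.ρ q

/-- `ι_t^{[0]}`, the null probability `exp (-λ_t π r_t²)`, and `ι_t^{[1]} = 1 - ι_t^{[0]}`. -/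
def iotaCoef (j : Fin 2) (t : ℕ) : ℝ :=
  if j = 1 then 1 - Real.exp (-(N.lam t * Real.pi * N.r t ^ 2))
  else Real.exp (-(N.lam t * Real.pi * N.r t ^ 2))

/-- The mean of `∏_{i=a}^{b} Ω_i φ_i`. -/
def xiBar (a b : ℕ) : ℝ := ∏ i ∈ Finset.Icc a b, N.harvestFactor i * N.meanGain i

/-- The thresholds `τ_M^{[i0]}` of slot `t`: `2^{(M-1) R_M} - 1` for `i = 0` and
`2^{(M-1) R_M / (1 - α_{t+1})} - 1` for `i = 1`. -/
def thresholdDirect (t : ℕ) (i : Fin 2) : ℝ :=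
  if i = 1 then (2 : ℝ) ^ (((N.M : ℝ) - 1) / (1 - N.α (t + 1)) * N.RM) - 1
  else (2 : ℝ) ^ (((N.M : ℝ) - 1) * N.RM) - 1

/-- The thresholds `τ_M^{[ij]}` of slot `t`. -/
def threshold (t : ℕ) (i j : Fin 2) : ℝ :=
  if j = 1 then
    N.thresholdDirect t i / (1 - (N.thresholdDirect t i + 1) * (1 - N.pM))
  else N.thresholdDirect t i

/-- The closed form of the complementary distribution function of the received SNR `X_{t+1}`. -/
def ccdfClosedForm (t : ℕ) (x : ℝ) : ℂ :=
  ((N.rhoCoef 0 t * Real.exp (-(x / (N.γ0 * N.meanGain (t + 1)))) : ℝ) : ℂ) +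
    ∑ τ ∈ Finset.Icc 1 (t - 1),
      ((N.rhoCoef 0 τ * ∏ j ∈ Finset.Icc (τ + 1) t, N.rhoCoef 1 j : ℝ) : ℂ) *
        meijerG (t - τ + 1) 0 [] (List.replicate (t - τ) 1 ++ [0])
          ((x / (N.γ0 * N.meanGain (t + 1) * N.xiBar (τ + 1) t) : ℝ) : ℂ)

end Network

/-- The random elements: fading coefficients `h q` of the hop from device `q - 1` to device `q`,
energy-harvesting indicators `I q` of device `q`, and the point sets `Φ t` of the active Type-II
devices around device `t`. -/
structure RandomState (Ω : Type*) where
  h : ℕ → Ω → ℂ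
  I : ℕ → Ω → Fin 2
  Φ : ℕ → Ω → Set Plane

/-- The σ-algebras generated by all fading coefficients, all harvesting indicators, and the point
set of slot `t`. -/
@[reducible] def RandomState.sigma {Ω : Type*} (S : RandomState Ω) (M t : ℕ) :
    (Set.Icc 2 M ⊕ Set.Icc 1 M) ⊕ Unit → MeasurableSpace Ω
  | .inl (.inl q) => MeasurableSpace.comap (S.h q) inferInstance
  | .inl (.inr q) => MeasurableSpace.comap (S.I q) inferInstance
  | .inr _ => pointSigma (S.Φ t)

/-- The probabilistic assumptions: `CN(0,1)` fading, Bernoulli harvesting indicators, homogeneous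
Poisson point processes, and independence. -/
structure IsNetworkModel {Ω : Type*} [MeasurableSpace Ω] (μ : Measure Ω) (N : Network)
    (S : RandomState Ω) : Prop where
  measurable_h : ∀ q ∈ Finset.Icc 2 N.M, Measurable (S.h q)
  law_h : ∀ q ∈ Finset.Icc 2 N.M, μ.map (S.h q) = complexGaussian
  measurable_I : ∀ q ∈ Finset.Icc 1 N.M, Measurable (S.I q)
  law_I : ∀ q ∈ Finset.Icc 1 N.M, μ.real {ω | S.I q ω = 1} = N.ρ q
  hppp : ∀ t ∈ Finset.Icc 1 (N.M - 1), IsHPPP μ (S.Φ t) (N.coverage t) (N.lam t)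
  indep : ∀ t ∈ Finset.Icc 1 (N.M - 1), iIndep (S.sigma N.M t) μ

/-- The two transmission schemes (both with the time-switching architecture): `TQoM` serves the
nearest active Type-II device, `TCoM` multiplexes the signals of `K_t` Type-II devices. -/
inductive Scheme where
  | TQoM
  | TCoM

namespace Network

variable (N : Network) {Ω : Type*} (S : RandomState Ω)

/-- Channel gain `φ_q = |h_q|² ℓ(l_q)`. -/
def gain (q : ℕ) (ω : Ω) : ℝ := ‖S.h q ω‖ ^ 2 * N.meanGain q

/-- Transmission power `P_t` of device `t` (`t ≥ 1`): the fixed power `P_0` if it does not harvest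
energy, and `Ω_t φ_t P_{t-1}` if it does; device `1` always uses `P_0`. -/
def txPower : ℕ → Ω → ℝ
  | 0, _ => N.P0
  | 1, _ => N.P0
  | t + 2, ω =>
    if S.I (t + 2) ω = 1 then
      N.harvestFactor (t + 2) * N.gain S (t + 2) ω * txPower (t + 1) ω
    else N.P0

/-- Received SNR `X_{t+1} = P_t φ_{t+1} / σ²` at device `t + 1` in slot `t`. -/
def snr (t : ℕ) (ω : Ω) : ℝ := N.txPower S t ω / N.noise * N.gain S (t + 1) ω

/-- Share of the transmit power of slot `t` carried by the Type-II signals, which interferes with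
`s_M` when at least one active Type-II device is present. -/
def interferenceShare (t : ℕ) : Scheme → ℝ
  | .TQoM => 1 - N.pM
  | .TCoM => ∑ k ∈ Finset.Icc 1 (N.K t), N.p t k

/-- Effective transmission time `τ_{t+1} = (1 - α_{t+1} I_{t+1}) / (M - 1)`. -/
def effectiveTime (t : ℕ) (ω : Ω) : ℝ :=
  (1 - N.α (t + 1) * ((S.I (t + 1) ω : ℕ) : ℝ)) / ((N.M : ℝ) - 1)

open Classical in
/-- Instantaneous rate at device `t + 1` in slot `t`. -/
def rate (s : Scheme) (t : ℕ) (ω : Ω) : ℝ :=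
  if 1 ≤ (S.Φ t ω).encard then
    N.effectiveTime S t ω *
      Real.logb 2 (1 + N.pM * N.txPower S t ω * N.gain S (t + 1) ω /
        (N.interferenceShare t s * N.txPower S t ω * N.gain S (t + 1) ω + N.noise))
  else
    N.effectiveTime S t ω *
      Real.logb 2 (1 + N.txPower S t ω * N.gain S (t + 1) ω / N.noise)

variable [MeasurableSpace Ω] (μ : Measure Ω)

/-- Outage probability at device `t + 1` in slot `t`. -/
def outageProb (s : Scheme) (t : ℕ) : ℝ := μ.real {ω | N.rate S s t ω < N.RM}

/-- The complementary distribution function `Pr[X_{t+1} ≥ x]` on `x > 0`.  It is set to `0` off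
`(0, ∞)`: a threshold `τ_M^{[i1]}` with non-positive denominator is one that no SNR reaches. -/
def snrCCDF (t : ℕ) (x : ℝ) : ℝ := if 0 < x then μ.real {ω | x ≤ N.snr S t ω} else 0

end Network

end

/-! Each gain `φ_q` is its mean times a standard exponential variable. A device that does not
harvest restarts from `P_0`, and one that does multiplies the previous received SNR by `Ω_t` and by
the next gain (`snr_succ_succ`). So if `τ` is the last device up to `t` that does not harvest (it
exists since `ρ_1 = 0`), the SNR is a constant times a product of `t - τ + 1` independent
exponentials. The closed form is the mixture over `τ`, proved by induction on `t` in
`ccdf_snr_eq_sum`: the indicator, the previous SNR and the new fading coefficient are independent.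

The tail `F_n` of such a product satisfies `F_{n+1}(z) = ∫ e^{-w} F_n(z/w) dw`. Each such step
multiplies the Mellin transform by `Γ(u+1)`, so `F_n` has transform `Γ(u) Γ(u+1)^n`
(`hasMellin_expProdCCDF`). Mellin inversion with `u = -s` is the Mellin-Barnes integral of the
G-function (`meijerG_eq_expProdCCDF`).

For the outage, the rate is an increasing function of the SNR once `I_{t+1}` and the emptiness of
`Φ_t` are fixed, so reaching the target means reaching a threshold (`target_le_rate_iff`). The four
cases are weighted by independence, as the SNR involves only indicators up to `t`. The power budget
makes the interference share the same in both schemes. -/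

noncomputable section

/-! ### Exponential law of the squared modulus of a complex Gaussian -/

open Set in
theorem lintegral_Ioi_mul_comp_sq (g : ℝ → ENNReal) :
    ∫⁻ r in Ioi (0 : ℝ), ENNReal.ofReal (2 * r) * g (r ^ 2) = ∫⁻ w in Ioi (0 : ℝ), g w := by
  have himg : (fun r : ℝ => r ^ 2) '' Ioi 0 = Ioi 0 := by
    ext w
    constructor
    · rintro ⟨r, hr, rfl⟩
      exact pow_pos (mem_Ioi.1 hr) 2
    · intro hw
      exact ⟨√w, Real.sqrt_pos.2 hw, Real.sq_sqrt (le_of_lt hw)⟩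
  have hinj : InjOn (fun r : ℝ => r ^ 2) (Ioi 0) := by
    intro a ha b hb hab
    exact (pow_left_inj₀ (le_of_lt ha) (le_of_lt hb) two_ne_zero).1 hab
  conv_rhs => rw [← himg]
  rw [lintegral_image_eq_lintegral_abs_deriv_mul (f' := fun r => 2 * r) measurableSet_Ioi
    (fun r _ => by simpa using (hasDerivAt_pow 2 r).hasDerivWithinAt) hinj]
  refine setLIntegral_congr_fun measurableSet_Ioi fun r hr => ?_
  rw [abs_of_pos (by have := mem_Ioi.1 hr; positivity)]

-- The joint density is `e^{-r²} / π`. In polar coordinates the angle contributes `2π`, and `w = r²`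
-- turns `2r dr` into `dw`.
open Set in
theorem lintegral_comp_normSq_complexGaussian {g : ℝ → ENNReal} (hg : Measurable g) :
    ∫⁻ z, g (‖z‖ ^ 2) ∂complexGaussian =
      ∫⁻ w in Ioi (0 : ℝ), ENNReal.ofReal (Real.exp (-w)) * g w := by
  have hm : Measurable fun u : ℝ × ℝ => (⟨u.1, u.2⟩ : ℂ) :=
    Complex.measurableEquivRealProd.symm.measurable
  have hv : (1 / 2 : NNReal) ≠ 0 := by norm_num
  rw [complexGaussian, lintegral_map (by fun_prop) hm, gaussianReal_of_var_ne_zero _ hv,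
    prod_withDensity (by fun_prop) (by fun_prop),
    lintegral_withDensity_eq_lintegral_mul _ (by fun_prop) (by fun_prop), ← Measure.volume_eq_prod,
    ← lintegral_comp_polarCoord_symm]
  -- The factor `r / π` is split as `(1 / (2π)) · 2r`: the first part cancels the length of the
  -- angle interval, the second is the Jacobian of `w = r²`.
  have hpt : ∀ p ∈ polarCoord.target, ENNReal.ofReal p.1 •
      ((fun z : ℝ × ℝ => gaussianPDF 0 (1 / 2) z.1 * gaussianPDF 0 (1 / 2) z.2) *
        fun a : ℝ × ℝ => g (‖(⟨a.1, a.2⟩ : ℂ)‖ ^ 2)) (polarCoord.symm p) =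
      ENNReal.ofReal (1 / (2 * Real.pi)) *
        (ENNReal.ofReal (2 * p.1) * (ENNReal.ofReal (Real.exp (-p.1 ^ 2)) * g (p.1 ^ 2))) := by
    rintro ⟨r, θ⟩ hp
    have hr : 0 < r := hp.1
    have hn : ‖(⟨r * Real.cos θ, r * Real.sin θ⟩ : ℂ)‖ ^ 2 = r ^ 2 := by
      rw [Complex.sq_norm, Complex.normSq_mk]
      linear_combination r ^ 2 * Real.cos_sq_add_sin_sq θ
    simp only [polarCoord_symm_apply, Pi.mul_apply, hn, smul_eq_mul, gaussianPDF]
    rw [← ENNReal.ofReal_mul (gaussianPDFReal_nonneg _ _ _), ← mul_assoc, ← mul_assoc, ← mul_assoc,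
      ← ENNReal.ofReal_mul hr.le, ← ENNReal.ofReal_mul (by positivity),
      ← ENNReal.ofReal_mul (by positivity)]
    congr 2
    simp only [gaussianPDFReal]
    have he : Real.exp (-(r * Real.cos θ - 0) ^ 2 / (2 * ((1 / 2 : NNReal) : ℝ))) *
        Real.exp (-(r * Real.sin θ - 0) ^ 2 / (2 * ((1 / 2 : NNReal) : ℝ))) =
        Real.exp (-r ^ 2) := by
      rw [← Real.exp_add]
      congr 1
      push_cast
      linear_combination -r ^ 2 * Real.cos_sq_add_sin_sq θ
    have hs : (√(2 * Real.pi * ((1 / 2 : NNReal) : ℝ)))⁻¹ *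
        (√(2 * Real.pi * ((1 / 2 : NNReal) : ℝ)))⁻¹ = 1 / Real.pi := by
      rw [← mul_inv, Real.mul_self_sqrt (by positivity)]
      push_cast
      field_simp
    calc _ = r * (((√(2 * Real.pi * ((1 / 2 : NNReal) : ℝ)))⁻¹ *
        (√(2 * Real.pi * ((1 / 2 : NNReal) : ℝ)))⁻¹) * (
        Real.exp (-(r * Real.cos θ - 0) ^ 2 / (2 * ((1 / 2 : NNReal) : ℝ))) *
        Real.exp (-(r * Real.sin θ - 0) ^ 2 / (2 * ((1 / 2 : NNReal) : ℝ))))) := by ring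
      _ = _ := by rw [he, hs]; field_simp
  rw [setLIntegral_congr_fun polarCoord.open_target.measurableSet hpt, polarCoord_target,
    Measure.volume_eq_prod, setLIntegral_prod _ (by fun_prop)]
  simp only [lintegral_const, Measure.restrict_apply MeasurableSet.univ, univ_inter,
    Real.volume_Ioo]
  rw [lintegral_mul_const _ (by fun_prop), lintegral_const_mul _ (by fun_prop),
    lintegral_Ioi_mul_comp_sq fun w => ENNReal.ofReal (Real.exp (-w)) * g w, mul_right_comm,
    ← ENNReal.ofReal_mul (by positivity)]
  rw [show 1 / (2 * Real.pi) * (Real.pi - -Real.pi) = 1 by field_simp; ring]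
  simp

/-! ### Tails of products of exponentials and their Mellin transforms -/

/-- The complementary distribution function of a product of `n + 1` independent standard
exponential variables. -/
def expProdCCDF : ℕ → ℝ → ℝ
  | 0, z => Real.exp (-z)
  | n + 1, z => ∫ w in Set.Ioi (0 : ℝ), Real.exp (-w) * expProdCCDF n (z / w)

theorem measurable_expProdCCDF (n : ℕ) : Measurable (expProdCCDF n) := by
  induction n with
  | zero => exact (by fun_prop : Measurable fun z : ℝ => Real.exp (-z))
  | succ n ih =>
    have : StronglyMeasurable fun z : ℝ =>
        ∫ w in Set.Ioi (0 : ℝ), Real.exp (-w) * expProdCCDF n (z / w) := by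
      apply StronglyMeasurable.integral_prod_right
        (f := fun z w => Real.exp (-w) * expProdCCDF n (z / w))
      apply Measurable.stronglyMeasurable
      exact (Real.measurable_exp.comp measurable_snd.neg).mul
        (ih.comp (measurable_fst.div measurable_snd))
    exact this.measurable

theorem integrableOn_exp_neg_mul {f : ℝ → ℝ} (hf : Measurable f)
    (hb : ∀ w, 0 < w → f w ∈ Set.Icc (0 : ℝ) 1) :
    IntegrableOn (fun w : ℝ => Real.exp (-w) * f w) (Set.Ioi 0) := by
  refine Integrable.mono' (integrableOn_exp_neg_Ioi 0)
    (by exact (Measurable.mul (by fun_prop) hf).aestronglyMeasurable) ?_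
  refine (ae_restrict_iff' measurableSet_Ioi).2 (Filter.Eventually.of_forall fun w hw => ?_)
  rw [Real.norm_of_nonneg (mul_nonneg (Real.exp_nonneg _) (hb w hw).1)]
  exact mul_le_of_le_one_right (Real.exp_nonneg _) (hb w hw).2

theorem expProdCCDF_mem_Icc (n : ℕ) {z : ℝ} (hz : 0 ≤ z) : expProdCCDF n z ∈ Set.Icc (0 : ℝ) 1 := by
  induction n generalizing z with
  | zero => exact ⟨Real.exp_nonneg _, Real.exp_le_one_iff.2 (neg_nonpos.2 hz)⟩
  | succ n ih =>
    have hb : ∀ w : ℝ, 0 < w → expProdCCDF n (z / w) ∈ Set.Icc (0 : ℝ) 1 :=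
      fun w hw => ih (div_nonneg hz hw.le)
    constructor
    · exact setIntegral_nonneg measurableSet_Ioi
        fun w hw => mul_nonneg (Real.exp_nonneg _) (hb w hw).1
    · calc expProdCCDF (n + 1) z ≤ ∫ w in Set.Ioi (0 : ℝ), Real.exp (-w) :=
            setIntegral_mono_on (integrableOn_exp_neg_mul
              ((measurable_expProdCCDF n).comp (by fun_prop)) hb) (integrableOn_exp_neg_Ioi 0)
              measurableSet_Ioi
              fun w hw => mul_le_of_le_one_right (Real.exp_nonneg _) (hb w hw).2
        _ = 1 := by rw [integral_exp_neg_Ioi]; simp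

/-- Dominated convergence with bound `e^{-w}`. Continuity is what makes Mellin inversion hold at
every point. -/
theorem continuousAt_expProdCCDF (n : ℕ) {z : ℝ} (hz : 0 < z) :
    ContinuousAt (expProdCCDF n) z := by
  induction n generalizing z with
  | zero => exact (by fun_prop : ContinuousAt (fun z : ℝ => Real.exp (-z)) z)
  | succ n ih =>
    refine continuousAt_of_dominated (F := fun z w => Real.exp (-w) * expProdCCDF n (z / w))
      (bound := fun w => Real.exp (-w)) ?_ ?_ (integrableOn_exp_neg_Ioi 0) ?_
    · refine Filter.Eventually.of_forall fun x => Measurable.aestronglyMeasurable ?_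
      exact Measurable.mul (by fun_prop) ((measurable_expProdCCDF n).comp (by fun_prop))
    · filter_upwards [lt_mem_nhds hz] with x hx
      refine (ae_restrict_iff' measurableSet_Ioi).2 (Filter.Eventually.of_forall fun w hw => ?_)
      have hb := expProdCCDF_mem_Icc n (div_nonneg hx.le (le_of_lt hw))
      rw [Real.norm_of_nonneg (mul_nonneg (Real.exp_nonneg _) hb.1)]
      exact mul_le_of_le_one_right (Real.exp_nonneg _) hb.2
    · refine (ae_restrict_iff' measurableSet_Ioi).2 (Filter.Eventually.of_forall fun w hw => ?_)
      have h1 : ContinuousAt (fun x : ℝ => expProdCCDF n (x / w)) z :=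
        ContinuousAt.comp (f := fun x : ℝ => x / w) (ih (div_pos hz hw)) (by fun_prop)
      exact continuousAt_const.mul h1

-- Replacing `x` by `x / w` multiplies the Mellin transform by `w^u`, and integrating `w^u` against
-- `e^{-w}` gives `Γ(u+1)`. Fubini justifies exchanging the two integrals.
open Set in
theorem hasMellin_expProdCCDF (n : ℕ) {u : ℂ} (hu : 0 < u.re) :
    HasMellin (fun x => (expProdCCDF n x : ℂ)) u
      (Complex.Gamma u * Complex.Gamma (u + 1) ^ n) := by
  induction n with
  | zero =>
    constructor
    · have := Complex.GammaIntegral_convergent hu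
      refine this.congr_fun (fun x _ => ?_) measurableSet_Ioi
      simp [expProdCCDF, mul_comm]
    · rw [mellin, Complex.Gamma_eq_integral hu, Complex.GammaIntegral]
      simp [expProdCCDF, mul_comm]
  | succ n ih =>
    obtain ⟨hconv, hval⟩ := ih
    set F := expProdCCDF n with hF
    have hu1 : 0 < (u + 1).re := by simpa using by linarith
    let H : ℝ × ℝ → ℂ := fun p =>
      ((p.1 : ℂ) ^ (u - 1)) * ((Real.exp (-p.2) * F (p.1 / p.2) : ℝ) : ℂ)
    have hHm : Measurable H := by
      refine Measurable.mul (by fun_prop) ?_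
      exact Complex.measurable_ofReal.comp (Measurable.mul (by fun_prop)
        ((measurable_expProdCCDF n).comp (by fun_prop)))
    have hsec : ∀ w : ℝ, 0 < w → HasMellin (fun x => (F (x / w) : ℂ)) u
        ((w : ℂ) ^ u * mellin (fun x => (F x : ℂ)) u) := by
      intro w hw
      have h1 := (MellinConvergent.comp_mul_left (f := fun x => (F x : ℂ)) (s := u)
        (inv_pos.2 hw)).2 hconv
      have h2 := mellin_comp_mul_left (fun x => (F x : ℂ)) u (inv_pos.2 hw)
      simp only [div_eq_inv_mul]
      refine ⟨h1, h2.trans ?_⟩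
      rw [smul_eq_mul, Complex.ofReal_inv, Complex.cpow_neg, Complex.inv_cpow, inv_inv]
      rw [Complex.arg_ofReal_of_nonneg hw.le]
      exact Real.pi_pos.ne
    -- The slice norms form a constant times the integrand of `Γ(Re u + 1)`, which gives the
    -- absolute integrability that Fubini needs.
    have hnorm : ∀ w : ℝ, 0 < w → ∫ x in Ioi (0 : ℝ), ‖H (x, w)‖ =
        (Real.exp (-w) * w ^ u.re) * ∫ x in Ioi (0 : ℝ), x ^ (u.re - 1) * F x := by
      intro w hw
      have h2 := integral_comp_mul_left_Ioi (fun x => x ^ (u.re - 1) * F (x / w)) 0 hw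
      rw [mul_zero, smul_eq_mul, eq_inv_mul_iff_mul_eq₀ hw.ne'] at h2
      calc ∫ x in Ioi (0 : ℝ), ‖H (x, w)‖
          = ∫ x in Ioi (0 : ℝ), Real.exp (-w) * (x ^ (u.re - 1) * F (x / w)) := by
            refine setIntegral_congr_fun measurableSet_Ioi fun x hx => ?_
            have hb := (expProdCCDF_mem_Icc n (div_nonneg (le_of_lt hx) hw.le)).1
            simp only [H]
            rw [norm_mul, Complex.norm_cpow_eq_rpow_re_of_pos hx, Complex.norm_real,
              Real.norm_of_nonneg (mul_nonneg (Real.exp_nonneg _) hb), Complex.sub_re,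
              Complex.one_re]
            ring
        _ = Real.exp (-w) *
              (w * ∫ x in Ioi (0 : ℝ), (w * x) ^ (u.re - 1) * F (w * x / w)) := by
            rw [integral_const_mul, h2]
        _ = Real.exp (-w) *
              (w * ∫ x in Ioi (0 : ℝ), w ^ (u.re - 1) * (x ^ (u.re - 1) * F x)) := by
            congr 2
            refine setIntegral_congr_fun measurableSet_Ioi fun x hx => ?_
            rw [Real.mul_rpow hw.le (le_of_lt hx), mul_div_cancel_left₀ _ hw.ne', mul_assoc]
        _ = _ := by
            rw [integral_const_mul, Real.rpow_sub_one hw.ne']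
            field_simp
    have hint : Integrable H ((volume.restrict (Ioi 0)).prod (volume.restrict (Ioi 0))) := by
      rw [integrable_prod_iff' hHm.aestronglyMeasurable]
      constructor
      · refine (ae_restrict_iff' measurableSet_Ioi).2 (Filter.Eventually.of_forall fun w hw => ?_)
        have := (hsec w hw).1.const_smul (Real.exp (-w) : ℂ)
        refine Integrable.congr this (Filter.Eventually.of_forall fun x => ?_)
        simp [H, mul_left_comm]
      · have h := (Real.GammaIntegral_convergent hu1).mul_const
          (∫ x in Ioi (0 : ℝ), x ^ (u.re - 1) * F x)
        refine IntegrableOn.congr_fun h (fun w hw => ?_) measurableSet_Ioi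
        rw [hnorm w hw]
        simp
    have hmul : ∀ x : ℝ, (x : ℂ) ^ (u - 1) • (expProdCCDF (n + 1) x : ℂ) =
        ∫ w in Ioi (0 : ℝ), H (x, w) := by
      intro x
      simp only [H]
      rw [integral_const_mul, smul_eq_mul]
      exact congrArg _ integral_ofReal.symm
    constructor
    · exact Integrable.congr hint.integral_prod_left
        (Filter.Eventually.of_forall fun x => (hmul x).symm)
    · calc mellin (fun x => (expProdCCDF (n + 1) x : ℂ)) u
          = ∫ x in Ioi (0 : ℝ), ∫ w in Ioi (0 : ℝ), H (x, w) := by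
            simp only [mellin, hmul]
        _ = ∫ w in Ioi (0 : ℝ), ∫ x in Ioi (0 : ℝ), H (x, w) := integral_integral_swap hint
        _ = ∫ w in Ioi (0 : ℝ), (Real.exp (-w) * (w : ℂ) ^ (u + 1 - 1)) *
              mellin (fun x => (F x : ℂ)) u := by
            refine setIntegral_congr_fun measurableSet_Ioi fun w hw => ?_
            have := (hsec w hw).2
            simp only [add_sub_cancel_right]
            rw [mul_assoc, ← this, mellin, ← integral_const_mul]
            simp [H, mul_left_comm]
        _ = _ := by
            rw [integral_mul_const, hval, pow_succ, Complex.Gamma_eq_integral hu1,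
              Complex.GammaIntegral]
            ring

/-! ### Vertical decay of Gamma and the Mellin-Barnes inversion -/

theorem norm_Gamma_le_Gamma_re {u : ℂ} (hu : 0 < u.re) :
    ‖Complex.Gamma u‖ ≤ Real.Gamma u.re := by
  rw [Complex.Gamma_eq_integral hu, Complex.GammaIntegral, Real.Gamma_eq_integral hu]
  refine (norm_integral_le_integral_norm _).trans_eq ?_
  refine setIntegral_congr_fun measurableSet_Ioi fun x hx => ?_
  rw [norm_mul, Complex.norm_cpow_eq_rpow_re_of_pos hx, Complex.norm_real,
    Real.norm_of_nonneg (Real.exp_nonneg _), Complex.sub_re, Complex.one_re]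

-- Writing `Γ(u) = Γ(u+2) / (u(u+1))` with a bounded numerator gives decay of order `|u|⁻²` on the
-- line. The other `n` factors only need to be bounded, so no Stirling estimate enters.
open Complex in
theorem verticalIntegrable_Gamma_mul_pow (n : ℕ) {σ : ℝ} (hσ : 0 < σ) :
    VerticalIntegrable (fun u => Gamma u * Gamma (u + 1) ^ n) σ := by
  -- The majorant comes from `|u|² = σ² (1 + (y/σ)²)`.
  have hdom : Integrable fun y : ℝ =>
      (Real.Gamma (σ + 2) * Real.Gamma (σ + 1) ^ n / σ ^ 2) * (1 + (y / σ) ^ 2)⁻¹ :=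
    ((integrable_inv_one_add_sq).comp_div hσ.ne').const_mul _
  have hre : ∀ y : ℝ, ((σ : ℂ) + y * I).re = σ := by intro y; simp
  refine hdom.mono' ?_ (Filter.Eventually.of_forall fun y => ?_)
  · refine Continuous.aestronglyMeasurable ?_
    have hΓ : ∀ a : ℝ, 0 ≤ a → Continuous fun y : ℝ => Gamma ((σ : ℂ) + y * I + a) := by
      intro a ha
      refine continuous_iff_continuousAt.2 fun y => ?_
      refine ContinuousAt.comp (f := fun y : ℝ => (σ : ℂ) + y * I + a) ?_ (by fun_prop)
      refine (differentiableAt_Gamma _ fun m hm => ?_).continuousAt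
      have := congrArg re hm
      simp at this
      have : (0 : ℝ) ≤ m := m.cast_nonneg
      linarith
    have h0 := hΓ 0 le_rfl
    have h1 := hΓ 1 zero_le_one
    simp only [ofReal_zero, add_zero, ofReal_one] at h0 h1
    exact h0.mul (h1.pow n)
  · set u : ℂ := (σ : ℂ) + y * I with hu
    have hur : u.re = σ := hre y
    have hu0 : u ≠ 0 := fun h => by rw [h] at hur; simp at hur; linarith
    have hu1 : u + 1 ≠ 0 := fun h => by
      have := congrArg re h; simp only [add_re, hur, one_re, zero_re] at this; linarith
    have hG : Gamma (u + 2) = (u + 1) * (u * Gamma u) := by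
      rw [← Gamma_add_one u hu0, ← Gamma_add_one _ hu1]; ring_nf
    have hsq : ‖u‖ ^ 2 = σ ^ 2 * (1 + (y / σ) ^ 2) := by
      rw [Complex.sq_norm, normSq_apply]
      simp [hu]
      field_simp
    have hle : ‖u‖ ≤ ‖u + 1‖ := by
      refine le_of_sq_le_sq ?_ (norm_nonneg _)
      rw [Complex.sq_norm, Complex.sq_norm, normSq_apply, normSq_apply]
      simp only [add_re, hur, one_re, add_im, one_im, add_zero]
      nlinarith
    have h2 : ‖Gamma (u + 2)‖ ≤ Real.Gamma (σ + 2) := by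
      simpa [hur] using norm_Gamma_le_Gamma_re (u := u + 2) (by simp [hur]; linarith)
    have h1 : ‖Gamma (u + 1)‖ ≤ Real.Gamma (σ + 1) := by
      simpa [hur] using norm_Gamma_le_Gamma_re (u := u + 1) (by simp [hur]; linarith)
    have hn0 : 0 < ‖u‖ := norm_pos_iff.2 hu0
    have h0 : ‖Gamma u‖ ≤ Real.Gamma (σ + 2) / ‖u‖ ^ 2 := by
      rw [le_div_iff₀ (by positivity)]
      refine le_trans ?_ h2
      rw [hG, norm_mul, norm_mul]
      nlinarith [norm_nonneg (Gamma u), mul_nonneg hn0.le (norm_nonneg (Gamma u)),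
        mul_le_mul_of_nonneg_right hle (mul_nonneg hn0.le (norm_nonneg (Gamma u)))]
    rw [norm_mul, norm_pow]
    calc ‖Gamma u‖ * ‖Gamma (u + 1)‖ ^ n
        ≤ (Real.Gamma (σ + 2) / ‖u‖ ^ 2) * Real.Gamma (σ + 1) ^ n := by
          gcongr
      _ = _ := by rw [hsq]; field_simp

-- Mellin inversion along `Re u = -c`, read through `u = -s`: the integrand becomes `Γ(-s) Γ(1-s)^n
-- z^s`, with lower parameters `0` and `n` ones.
open Complex in
theorem meijerG_eq_expProdCCDF (n : ℕ) {z : ℝ} (hz : 0 < z) :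
    meijerG (n + 1) 0 [] (List.replicate n 1 ++ [0]) (z : ℂ) = (expProdCCDF n z : ℂ) := by
  have htake : (List.replicate n (1 : ℂ) ++ [0]).take (n + 1) = List.replicate n 1 ++ [0] :=
    List.take_of_length_le (by simp)
  have hdrop : (List.replicate n (1 : ℂ) ++ [0]).drop (n + 1) = [] :=
    List.drop_eq_nil_of_le (by simp)
  have hex : ∃ c : ℝ, MeijerSeparates (n + 1) 0 [] (List.replicate n 1 ++ [0]) c := by
    refine ⟨-1, fun β hβ => ?_, by simp⟩
    rw [htake, List.mem_append, List.mem_replicate, List.mem_singleton] at hβ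
    rcases hβ with ⟨-, rfl⟩ | rfl <;> norm_num
  rw [meijerG, dif_pos hex]
  -- The line in the definition is an arbitrary choice. The parameter `0` forces `c < 0`, which is
  -- all the inversion needs, so `c` is then generalized.
  have hc : hex.choose < 0 := by
    have := hex.choose_spec.1 0 (by rw [htake]; simp)
    simpa using this
  generalize hex.choose = c at hc
  have hσ : 0 < -c := neg_pos.2 hc
  have hF : ∀ u : ℂ, 0 < u.re → mellin (fun x => (expProdCCDF n x : ℂ)) u =
      Gamma u * Gamma (u + 1) ^ n := fun u hu => (hasMellin_expProdCCDF n hu).2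
  have hinv := mellinInv_mellin_eq (-c) (fun x => (expProdCCDF n x : ℂ)) hz
    (hasMellin_expProdCCDF n (by simpa using hσ)).1
    (by
      refine (verticalIntegrable_Gamma_mul_pow n hσ).congr
        (Filter.Eventually.of_forall fun y => ?_)
      exact (hF _ (by simpa using hc)).symm)
    (continuous_ofReal.continuousAt.comp (continuousAt_expProdCCDF n hz))
  rw [← hinv, mellinInv, real_smul]
  congr 1
  · push_cast
    rfl
  -- The reflection `y ↦ -y` turns the line of `u = -s` into that of `s`.
  · rw [← integral_neg_eq_self]
    congr 1
    ext y
    rw [hF _ (by simpa using hc), meijerIntegrand, htake, hdrop]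
    simp only [List.map_append, List.map_replicate, List.prod_append, List.prod_replicate,
      List.map_cons, List.map_nil, List.prod_cons, List.prod_nil, List.take_nil, List.drop_nil,
      mul_one, div_one, smul_eq_mul]
    rw [mul_comm]
    congr 1
    · congr 1; push_cast; ring
    · rw [mul_comm]
      congr 2
      · push_cast; ring
      · congr 1; push_cast; ring

/-! ### Multiplication by an independent fading gain -/

/-- Condition on `‖Z‖² = w`: the joint law is a product and `w` has density `e^{-w}`. This produces
the recursion defining `expProdCCDF`. -/
theorem measureReal_le_mul_normSq {Ω : Type*} [MeasurableSpace Ω] {μ : Measure Ω}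
    [IsProbabilityMeasure μ] {X : Ω → ℝ} {Z : Ω → ℂ} (hX : Measurable X) (hZ : Measurable Z)
    (hlaw : μ.map Z = complexGaussian) (hind : IndepFun X Z μ) {c : ℝ} (hc : 0 < c) (x : ℝ) :
    μ.real {ω | x ≤ X ω * (‖Z ω‖ ^ 2 * c)} =
      ∫ w in Set.Ioi (0 : ℝ), Real.exp (-w) * μ.real {ω | x / (c * w) ≤ X ω} := by
  set g : ℝ → ENNReal := fun v => (μ.map X) {a | x ≤ a * (v * c)} with hg
  have hPX : IsProbabilityMeasure (μ.map X) := Measure.isProbabilityMeasure_map hX.aemeasurable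
  have hPZ : IsProbabilityMeasure (μ.map Z) := Measure.isProbabilityMeasure_map hZ.aemeasurable
  have hgm : Measurable g := by
    have hs : MeasurableSet {p : ℝ × ℝ | x ≤ p.1 * (p.2 * c)} :=
      measurableSet_le (by fun_prop) (by fun_prop)
    exact measurable_measure_prodMk_right hs
  have hs : MeasurableSet {p : ℝ × ℂ | x ≤ p.1 * (‖p.2‖ ^ 2 * c)} :=
    measurableSet_le (by fun_prop) (by fun_prop)
  have h1 : μ {ω | x ≤ X ω * (‖Z ω‖ ^ 2 * c)} =
      ∫⁻ w in Set.Ioi (0 : ℝ), ENNReal.ofReal (Real.exp (-w)) * g w := by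
    have : μ {ω | x ≤ X ω * (‖Z ω‖ ^ 2 * c)} =
        (μ.map fun ω => (X ω, Z ω)) {p : ℝ × ℂ | x ≤ p.1 * (‖p.2‖ ^ 2 * c)} := by
      rw [Measure.map_apply (by fun_prop) hs]
      rfl
    rw [this, (indepFun_iff_map_prod_eq_prod_map_map hX.aemeasurable hZ.aemeasurable).1 hind,
      Measure.prod_apply_symm hs, hlaw, ← lintegral_comp_normSq_complexGaussian hgm]
    rfl
  have hgX : ∀ w : ℝ, 0 < w → (g w).toReal = μ.real {ω | x / (c * w) ≤ X ω} := by
    intro w hw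
    have hms : MeasurableSet {a : ℝ | x ≤ a * (w * c)} :=
      measurableSet_le (by fun_prop) (by fun_prop)
    rw [hg, measureReal_def]
    simp only
    rw [Measure.map_apply hX hms]
    congr 2
    ext ω
    simp only [Set.mem_preimage, Set.mem_ofPred_eq]
    rw [div_le_iff₀ (by positivity), mul_comm c w]
  rw [measureReal_def, h1, integral_eq_lintegral_of_nonneg_ae]
  · congr 1
    refine setLIntegral_congr_fun measurableSet_Ioi fun w hw => ?_
    rw [← hgX w hw, ENNReal.ofReal_mul (Real.exp_nonneg _),
      ENNReal.ofReal_toReal (measure_ne_top _ _)]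
  · exact Filter.Eventually.of_forall fun w => mul_nonneg (Real.exp_nonneg _) measureReal_nonneg
  · have : AEStronglyMeasurable (fun w : ℝ => Real.exp (-w) * (g w).toReal)
        (volume.restrict (Set.Ioi 0)) := by
      refine Measurable.aestronglyMeasurable ?_
      exact Measurable.mul (by fun_prop) hgm.ennreal_toReal
    refine this.congr ?_
    refine (ae_restrict_iff' measurableSet_Ioi).2 (Filter.Eventually.of_forall fun w hw => ?_)
    simp only
    rw [hgX w hw]

theorem measureReal_le_normSq {Ω : Type*} [MeasurableSpace Ω] {μ : Measure Ω} {Z : Ω → ℂ}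
    (hZ : Measurable Z) (hlaw : μ.map Z = complexGaussian) {y : ℝ} (hy : 0 < y) :
    μ.real {ω | y ≤ ‖Z ω‖ ^ 2} = Real.exp (-y) := by
  have hs : MeasurableSet (Set.Ici y) := measurableSet_Ici
  have h1 : μ {ω | y ≤ ‖Z ω‖ ^ 2} =
      ∫⁻ z, (Set.Ici y).indicator 1 (‖z‖ ^ 2) ∂complexGaussian := by
    rw [← hlaw, lintegral_map (by fun_prop (disch := measurability)) hZ]
    have := lintegral_indicator_one (μ := μ) (s := {ω | y ≤ ‖Z ω‖ ^ 2})
      (measurableSet_le measurable_const (by fun_prop))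
    rw [← this]
    rfl
  rw [measureReal_def, h1,
    lintegral_comp_normSq_complexGaussian (measurable_one.indicator hs)]
  have h2 : ∀ w : ℝ, ENNReal.ofReal (Real.exp (-w)) * (Set.Ici y).indicator 1 w =
      (Set.Ici y).indicator (fun w => ENNReal.ofReal (Real.exp (-w))) w := by
    intro w
    by_cases h : w ∈ Set.Ici y <;> simp [h]
  simp only [h2]
  rw [lintegral_indicator hs, Measure.restrict_restrict hs,
    Set.inter_eq_left.2 (Set.Ici_subset_Ioi.2 hy),
    ← ofReal_integral_eq_lintegral_ofReal, integral_Ici_eq_integral_Ioi, integral_exp_neg_Ioi,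
    ENNReal.toReal_ofReal (Real.exp_nonneg _)]
  · exact (integrableOn_Ici_iff_integrableOn_Ioi (by simp)).2 (integrableOn_exp_neg_Ioi y)
  · exact Filter.Eventually.of_forall fun w => Real.exp_nonneg _

/-! ### Signs of the parameters and the SNR recursion -/

namespace Network

variable {N : Network}

theorem Admissible.meanGain_pos (hN : N.Admissible) {q : ℕ} (hq : q ∈ Finset.Icc 2 N.M) :
    0 < N.meanGain q := by
  have h := dist_pos.2 (hN.pos_ne q hq)
  exact mul_pos hN.Lc_pos (Real.rpow_pos_of_pos (div_pos hN.d0_pos h) _)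

theorem Admissible.harvestFactor_nonneg (hN : N.Admissible) {q : ℕ} (hq : q ∈ Finset.Icc 2 N.M) :
    0 ≤ N.harvestFactor q := by
  have h1 := hN.α_mem q hq
  have h2 := hN.η_mem q hq
  exact div_nonneg (mul_nonneg (mul_nonneg hN.κ_pos.le h1.1) h2.1) (sub_nonneg.2 h1.2.le)

theorem Admissible.harvestFactor_pos (hN : N.Admissible) {q : ℕ} (hq : q ∈ Finset.Icc 2 N.M)
    (hα : 0 < N.α q) (hη : 0 < N.η q) : 0 < N.harvestFactor q :=
  div_pos (mul_pos (mul_pos hN.κ_pos hα) hη) (sub_pos.2 (hN.α_mem q hq).2)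

theorem Admissible.γ0_pos (hN : N.Admissible) : 0 < N.γ0 := div_pos hN.P0_pos hN.noise_pos

theorem Admissible.xiBar_nonneg (hN : N.Admissible) {a b : ℕ} (ha : 2 ≤ a) (hb : b ≤ N.M) :
    0 ≤ N.xiBar a b := by
  refine Finset.prod_nonneg fun i hi => ?_
  have hi' : i ∈ Finset.Icc 2 N.M := by
    rw [Finset.mem_Icc] at hi ⊢
    omega
  exact mul_nonneg (hN.harvestFactor_nonneg hi') (hN.meanGain_pos hi').le

/-- For `TCoM` this is the power budget. It is the reason why the outage does not depend on the
scheme. -/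
theorem interferenceShare_eq (hN : N.Admissible) {t : ℕ} (ht : t ∈ Finset.Icc 1 (N.M - 1))
    (s : Scheme) : N.interferenceShare t s = 1 - N.pM := by
  cases s with
  | TQoM => rfl
  | TCoM => exact eq_sub_of_add_eq' (hN.power_budget t ht)

variable {Ω : Type*} (S : RandomState Ω)

theorem Admissible.gain_nonneg (hN : N.Admissible) {q : ℕ} (hq : q ∈ Finset.Icc 2 N.M) (ω : Ω) :
    0 ≤ N.gain S q ω := mul_nonneg (by positivity) (hN.meanGain_pos hq).le

theorem Admissible.txPower_nonneg (hN : N.Admissible) {t : ℕ} (ht : t ≤ N.M) (ω : Ω) :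
    0 ≤ N.txPower S t ω := by
  induction t with
  | zero => exact hN.P0_pos.le
  | succ t ih =>
    cases t with
    | zero => exact hN.P0_pos.le
    | succ t =>
      have hq : t + 2 ∈ Finset.Icc 2 N.M := Finset.mem_Icc.2 ⟨by omega, ht⟩
      rw [txPower]
      split_ifs
      · exact mul_nonneg (mul_nonneg (hN.harvestFactor_nonneg hq) (hN.gain_nonneg S hq ω))
          (ih (by omega))
      · exact hN.P0_pos.le

theorem Admissible.snr_nonneg (hN : N.Admissible) {t : ℕ} (ht : t ∈ Finset.Icc 1 (N.M - 1)) (ω : Ω) :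
    0 ≤ N.snr S t ω := by
  rw [Finset.mem_Icc] at ht
  exact mul_nonneg (div_nonneg (hN.txPower_nonneg S (by omega) ω) hN.noise_pos.le)
    (hN.gain_nonneg S (Finset.mem_Icc.2 (by omega)) ω)

/-- The harvested power `Ω_{t+2} φ_{t+2} P_{t+1}` contains the product `φ_{t+2} P_{t+1}` that is
also the previous received signal power. Hence the recursion closes on the SNR itself, with a fresh
gain as multiplier. -/
theorem snr_succ_succ (hN : N.Admissible) (t : ℕ) (ω : Ω) :
    N.snr S (t + 2) ω = if S.I (t + 2) ω = 1 then
      N.snr S (t + 1) ω * (‖S.h (t + 3) ω‖ ^ 2 * (N.harvestFactor (t + 2) * N.meanGain (t + 3)))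
    else N.γ0 * N.gain S (t + 3) ω := by
  have := hN.noise_pos.ne'
  simp only [snr, txPower, γ0, gain]
  split_ifs
  · field_simp
  · rfl

end Network

/-! # Independence of past and future -/

/-- The indices of the fading coefficients up to `a` and of the harvesting indicators up to `b`. -/
def pastIndex (M a b : ℕ) : Set ((Set.Icc 2 M ⊕ Set.Icc 1 M) ⊕ Unit) :=
  {i | (∃ q, i = .inl (.inl q) ∧ q.1 ≤ a) ∨ ∃ q, i = .inl (.inr q) ∧ q.1 ≤ b}

/-- The σ-algebra generated by the random elements with indices in `J`. -/
@[reducible] def RandomState.jointSigma {Ω : Type*} (S : RandomState Ω) (M T : ℕ)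
    (J : Set ((Set.Icc 2 M ⊕ Set.Icc 1 M) ⊕ Unit)) : MeasurableSpace Ω :=
  ⨆ i ∈ J, S.sigma M T i

section Past

variable {Ω : Type*} (S : RandomState Ω) {M T : ℕ} {J : Set ((Set.Icc 2 M ⊕ Set.Icc 1 M) ⊕ Unit)}

theorem measurable_h_jointSigma {q : ℕ} (hq : q ∈ Set.Icc 2 M) (hJ : .inl (.inl ⟨q, hq⟩) ∈ J) :
    Measurable[S.jointSigma M T J] (S.h q) :=
  Measurable.mono (comap_measurable (S.h q))
    (le_iSup₂_of_le (f := fun i (_ : i ∈ J) => S.sigma M T i) _ hJ le_rfl) le_rfl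

theorem measurable_I_jointSigma {q : ℕ} (hq : q ∈ Set.Icc 1 M) (hJ : .inl (.inr ⟨q, hq⟩) ∈ J) :
    Measurable[S.jointSigma M T J] (S.I q) :=
  Measurable.mono (comap_measurable (S.I q))
    (le_iSup₂_of_le (f := fun i (_ : i ∈ J) => S.sigma M T i) _ hJ le_rfl) le_rfl

theorem measurable_encard_jointSigma (hJ : .inr () ∈ J) :
    Measurable[S.jointSigma M T J] fun ω => (S.Φ T ω).encard := by
  -- The total number of points is the count in `Set.univ`, one of the generators.
  have h : Measurable[pointSigma (S.Φ T)] fun ω => (S.Φ T ω ∩ Set.univ).encard :=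
    Measurable.mono (comap_measurable _)
      (le_iSup₂_of_le (f := fun (B : Set Plane) (_ : MeasurableSet B) =>
        MeasurableSpace.comap (fun ω => (S.Φ T ω ∩ B).encard) inferInstance)
        Set.univ MeasurableSet.univ le_rfl) le_rfl
  simp only [Set.inter_univ] at h
  exact Measurable.mono h
    (le_iSup₂_of_le (f := fun i (_ : i ∈ J) => S.sigma M T i) _ hJ le_rfl) le_rfl

variable {N : Network}

theorem measurable_gain_jointSigma {J : Set ((Set.Icc 2 N.M ⊕ Set.Icc 1 N.M) ⊕ Unit)}
    {q : ℕ} (hq : q ∈ Set.Icc 2 N.M) (hJ : .inl (.inl ⟨q, hq⟩) ∈ J) :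
    Measurable[S.jointSigma N.M T J] (N.gain S q) := by
  have := measurable_h_jointSigma S (T := T) hq hJ
  exact ((measurable_norm.comp this).pow_const 2).mul_const _

theorem measurable_txPower_pastIndex {t a b : ℕ} (ht : t ≤ N.M) (ha : t ≤ a) (hb : t ≤ b) :
    Measurable[S.jointSigma N.M T (pastIndex N.M a b)] (N.txPower S t) := by
  induction t with
  | zero => exact measurable_const
  | succ t ih =>
    cases t with
    | zero => exact measurable_const
    | succ t =>
      have h1 := measurable_I_jointSigma S (T := T) (J := pastIndex N.M a b) (q := t + 2)
        ⟨by omega, ht⟩ (Or.inr ⟨_, rfl, hb⟩)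
      have h2 := measurable_gain_jointSigma S (T := T) (J := pastIndex N.M a b) (q := t + 2)
        ⟨by omega, ht⟩ (Or.inl ⟨_, rfl, ha⟩)
      have h3 := ih (by omega) (by omega) (by omega)
      exact Measurable.ite (m := S.jointSigma N.M T (pastIndex N.M a b))
        (h1 (measurableSet_singleton 1)) ((h2.const_mul _).mul h3) measurable_const

/-- The two bounds differ on purpose: fading is used up to `t + 1`, indicators only up to `t`. This
leaves `I_{t+1}` independent of the SNR. -/
theorem measurable_snr_pastIndex {t a b : ℕ} (ht : t ∈ Finset.Icc 1 (N.M - 1)) (ha : t + 1 ≤ a)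
    (hb : t ≤ b) : Measurable[S.jointSigma N.M T (pastIndex N.M a b)] (N.snr S t) := by
  rw [Finset.mem_Icc] at ht
  have h1 := measurable_txPower_pastIndex S (N := N) (T := T) (t := t) (a := a) (b := b)
    (by omega) (by omega) (by omega)
  have h2 := measurable_gain_jointSigma S (T := T) (J := pastIndex N.M a b) (q := t + 1)
    ⟨by omega, by omega⟩ (Or.inl ⟨_, rfl, ha⟩)
  exact (h1.div_const _).mul h2

end Past

/-! ### Distribution of the received SNR -/

namespace IsNetworkModel

variable {Ω : Type*} [mΩ : MeasurableSpace Ω] {μ : Measure Ω} {N : Network} {S : RandomState Ω}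
  {T : ℕ}

theorem sigma_le (hS : IsNetworkModel μ N S) (hT : T ∈ Finset.Icc 1 (N.M - 1)) :
    ∀ i, S.sigma N.M T i ≤ mΩ
  | .inl (.inl q) => (hS.measurable_h q (Finset.mem_Icc.2 q.2)).comap_le
  | .inl (.inr q) => (hS.measurable_I q (Finset.mem_Icc.2 q.2)).comap_le
  | .inr _ => iSup₂_le fun B hB => ((hS.hppp T hT).measurable_count B hB).comap_le

theorem jointSigma_le (hS : IsNetworkModel μ N S) (hT : T ∈ Finset.Icc 1 (N.M - 1))
    (J : Set ((Set.Icc 2 N.M ⊕ Set.Icc 1 N.M) ⊕ Unit)) : S.jointSigma N.M T J ≤ mΩ :=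
  iSup₂_le fun i _ => hS.sigma_le hT i

theorem indep_jointSigma (hS : IsNetworkModel μ N S) (hT : T ∈ Finset.Icc 1 (N.M - 1))
    {J K : Set ((Set.Icc 2 N.M ⊕ Set.Icc 1 N.M) ⊕ Unit)} (h : Disjoint J K) :
    Indep (S.jointSigma N.M T J) (S.jointSigma N.M T K) μ :=
  indep_iSup_of_disjoint (hS.sigma_le hT) (hS.indep T hT) h

theorem measureReal_inter (hS : IsNetworkModel μ N S) (hT : T ∈ Finset.Icc 1 (N.M - 1))
    {J K : Set ((Set.Icc 2 N.M ⊕ Set.Icc 1 N.M) ⊕ Unit)} (h : Disjoint J K) {A B : Set Ω}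
    (hA : MeasurableSet[S.jointSigma N.M T J] A) (hB : MeasurableSet[S.jointSigma N.M T K] B) :
    μ.real (A ∩ B) = μ.real A * μ.real B := by
  rw [measureReal_def, (Indep_iff _ _ μ).1 (hS.indep_jointSigma hT h) A B hA hB,
    ENNReal.toReal_mul]
  rfl

theorem measurable_snr (hS : IsNetworkModel μ N S) {t : ℕ} (ht : t ∈ Finset.Icc 1 (N.M - 1)) :
    Measurable (N.snr S t) :=
  (measurable_snr_pastIndex S (T := t) ht le_rfl le_rfl).mono (hS.jointSigma_le ht _) le_rfl

theorem measureReal_I (hS : IsNetworkModel μ N S) [IsProbabilityMeasure μ] {q : ℕ}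
    (hq : q ∈ Finset.Icc 1 N.M) (i : Fin 2) : μ.real {ω | S.I q ω = i} = N.rhoCoef i q := by
  have h1 := hS.law_I q hq
  have hm : MeasurableSet {ω | S.I q ω = 1} := hS.measurable_I q hq (measurableSet_singleton 1)
  fin_cases i
  · have : {ω | S.I q ω = 0} = {ω | S.I q ω = 1}ᶜ := by
      ext ω
      simp only [Set.mem_ofPred_eq, Set.mem_compl_iff]
      omega
    simp only [Network.rhoCoef, Fin.zero_eta]
    rw [this, probReal_compl_eq_one_sub hm, h1]
    simp
  · simpa [Network.rhoCoef] using h1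

theorem measureReal_le_mul_gain (hS : IsNetworkModel μ N S) (hN : N.Admissible) {q : ℕ}
    (hq : q ∈ Finset.Icc 2 N.M) {x : ℝ} (hx : 0 < x) :
    μ.real {ω | x ≤ N.γ0 * N.gain S q ω} = Real.exp (-(x / (N.γ0 * N.meanGain q))) := by
  have hc : 0 < N.γ0 * N.meanGain q := mul_pos hN.γ0_pos (hN.meanGain_pos hq)
  rw [← measureReal_le_normSq (hS.measurable_h q hq) (hS.law_h q hq) (div_pos hx hc)]
  congr 1
  ext ω
  simp only [Set.mem_ofPred_eq, Network.gain]
  rw [div_le_iff₀ hc]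
  ring_nf

theorem ccdf_snr_one (hS : IsNetworkModel μ N S) (hN : N.Admissible) {x : ℝ} (hx : 0 < x) :
    μ.real {ω | x ≤ N.snr S 1 ω} = Real.exp (-(x / (N.γ0 * N.meanGain 2))) :=
  hS.measureReal_le_mul_gain hN (Finset.mem_Icc.2 ⟨le_rfl, hN.two_le_M⟩) hx

theorem indepFun_snr_h (hS : IsNetworkModel μ N S) {t q : ℕ} (ht : t ∈ Finset.Icc 1 (N.M - 1))
    (hq : q ∈ Finset.Icc 2 N.M) (htq : t + 1 < q) : IndepFun (N.snr S t) (S.h q) μ := by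
  have hq' : q ∈ Set.Icc 2 N.M := Finset.mem_Icc.1 hq
  have hd : Disjoint (pastIndex N.M (t + 1) t) {.inl (.inl ⟨q, hq'⟩)} := by
    rw [Set.disjoint_singleton_right]
    rintro (⟨p, hp, hle⟩ | ⟨p, hp, -⟩)
    · simp only [Sum.inl.injEq] at hp
      rw [← hp] at hle
      simp only at hle
      omega
    · simp at hp
  have hmh : Measurable[S.jointSigma N.M t {.inl (.inl ⟨q, hq'⟩)}] (S.h q) :=
    measurable_h_jointSigma S hq' (Set.mem_singleton _)
  have hms := measurable_snr_pastIndex S (T := t) (a := t + 1) (b := t) ht le_rfl le_rfl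
  exact (IndepFun_iff_Indep _ _ μ).2 (indep_of_indep_of_le_left (indep_of_indep_of_le_right
    (hS.indep_jointSigma ht hd) hmh.comap_le) hms.comap_le)

/-- Split on `I_{t+2}`, which is independent of both continuations: harvesting multiplies the old
SNR by an independent gain, not harvesting restarts from `P_0`. -/
theorem ccdf_snr_succ_succ (hS : IsNetworkModel μ N S) [IsProbabilityMeasure μ]
    (hN : N.Admissible) {t : ℕ} (ht : t + 3 ≤ N.M)
    (hpos : 0 < N.ρ (t + 2) → 0 < N.harvestFactor (t + 2)) {x : ℝ} (hx : 0 < x) :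
    μ.real {ω | x ≤ N.snr S (t + 2) ω} =
      N.rhoCoef 1 (t + 2) * (∫ w in Set.Ioi (0 : ℝ), Real.exp (-w) * μ.real {ω |
        x / (N.harvestFactor (t + 2) * N.meanGain (t + 3) * w) ≤ N.snr S (t + 1) ω}) +
      N.rhoCoef 0 (t + 2) * Real.exp (-(x / (N.γ0 * N.meanGain (t + 3)))) := by
  have hT : t + 1 ∈ Finset.Icc 1 (N.M - 1) := Finset.mem_Icc.2 (by omega)
  have hI1 : t + 2 ∈ Set.Icc 1 N.M := ⟨by omega, by omega⟩
  have hh : t + 3 ∈ Set.Icc 2 N.M := ⟨by omega, by omega⟩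
  have hmI := measurable_I_jointSigma S (T := t + 1) (J := {.inl (.inr ⟨t + 2, hI1⟩)}) hI1 rfl
  have hmg := measurable_gain_jointSigma S (N := N) (T := t + 1)
    (J := pastIndex N.M (t + 3) (t + 1)) hh (Or.inl ⟨_, rfl, le_rfl⟩)
  have hmh := measurable_h_jointSigma S (T := t + 1)
    (J := pastIndex N.M (t + 3) (t + 1)) hh (Or.inl ⟨_, rfl, le_rfl⟩)
  have hms := measurable_snr_pastIndex S (T := t + 1) (a := t + 3) (b := t + 1) hT
    (by omega) le_rfl
  have hdis : Disjoint ({.inl (.inr ⟨t + 2, hI1⟩)} : Set ((Set.Icc 2 N.M ⊕ Set.Icc 1 N.M) ⊕ Unit))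
      (pastIndex N.M (t + 3) (t + 1)) := by
    rw [Set.disjoint_singleton_left]
    rintro (⟨q, hq, -⟩ | ⟨q, hq, hle⟩)
    · simp at hq
    · simp only [Sum.inl.injEq, Sum.inr.injEq] at hq
      rw [← hq] at hle
      simp at hle
  set A := {ω | x ≤ N.snr S (t + 1) ω *
    (‖S.h (t + 3) ω‖ ^ 2 * (N.harvestFactor (t + 2) * N.meanGain (t + 3)))} with hA
  set B := {ω | x ≤ N.γ0 * N.gain S (t + 3) ω} with hB
  have hAm : MeasurableSet[S.jointSigma N.M (t + 1) (pastIndex N.M (t + 3) (t + 1))] A :=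
    (hms.mul (((measurable_norm.comp hmh).pow_const 2).mul_const _)) measurableSet_Ici
  have hBm : MeasurableSet[S.jointSigma N.M (t + 1) (pastIndex N.M (t + 3) (t + 1))] B :=
    (hmg.const_mul _) measurableSet_Ici
  have hEm : ∀ i, MeasurableSet[S.jointSigma N.M (t + 1) {.inl (.inr ⟨t + 2, hI1⟩)}]
      {ω | S.I (t + 2) ω = i} := fun i => hmI (measurableSet_singleton i)
  have hle := hS.jointSigma_le hT
  have hsplit : {ω | x ≤ N.snr S (t + 2) ω} =
      ({ω | S.I (t + 2) ω = 1} ∩ A) ∪ ({ω | S.I (t + 2) ω = 0} ∩ B) := by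
    ext ω
    simp only [Set.mem_ofPred_eq, Network.snr_succ_succ S hN, Set.mem_union, Set.mem_inter_iff, hA,
      hB]
    by_cases h : S.I (t + 2) ω = 1
    · simp [h]
    · simp [show S.I (t + 2) ω = 0 by omega]
  have hdj : Disjoint ({ω | S.I (t + 2) ω = 1} ∩ A) ({ω | S.I (t + 2) ω = 0} ∩ B) := by
    rw [Set.disjoint_left]
    rintro ω ⟨h1, -⟩ ⟨h0, -⟩
    simp only [Set.mem_ofPred_eq] at h1 h0
    omega
  rw [hsplit, measureReal_union hdj
      (MeasurableSet.inter (hle _ _ (hEm 0)) (hle _ _ hBm)),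
    hS.measureReal_inter hT hdis (hEm 1) hAm,
    hS.measureReal_inter hT hdis (hEm 0) hBm,
    hS.measureReal_I (Finset.mem_Icc.2 hI1), hS.measureReal_I (Finset.mem_Icc.2 hI1),
    hS.measureReal_le_mul_gain hN (Finset.mem_Icc.2 hh) hx]
  congr 1
  -- `Ω_{t+2}` is known to be positive only if `ρ_{t+2} > 0`; otherwise the harvesting term has
  -- coefficient `0`.
  rcases (hN.ρ_mem (t + 2) (Finset.mem_Icc.2 hI1)).1.eq_or_lt with h0 | h0
  · simp [Network.rhoCoef, ← h0]
  · congr 1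
    refine measureReal_le_mul_normSq (hS.measurable_snr hT)
      (hS.measurable_h _ (Finset.mem_Icc.2 hh)) (hS.law_h _ (Finset.mem_Icc.2 hh)) ?_
      (mul_pos (hpos h0) (hN.meanGain_pos (Finset.mem_Icc.2 hh))) x
    exact hS.indepFun_snr_h hT (Finset.mem_Icc.2 hh) (by omega)

/-- The index `τ` is the last device that does not harvest. One more slot lengthens every existing
harvesting run by one exponential factor and adds the new term `τ = t + 2`, whose run is empty. -/
theorem ccdf_snr_eq_sum (hS : IsNetworkModel μ N S) [IsProbabilityMeasure μ]
    (hN : N.Admissible) {t : ℕ} (ht : t + 2 ≤ N.M)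
    (hpos : ∀ q ∈ Finset.Icc 2 (t + 1), 0 < N.ρ q → 0 < N.α q ∧ 0 < N.η q) {x : ℝ} (hx : 0 < x) :
    μ.real {ω | x ≤ N.snr S (t + 1) ω} = ∑ τ ∈ Finset.Icc 1 (t + 1),
      (N.rhoCoef 0 τ * ∏ j ∈ Finset.Icc (τ + 1) (t + 1), N.rhoCoef 1 j) *
        expProdCCDF (t + 1 - τ)
          (x / (N.γ0 * N.meanGain (t + 2) * N.xiBar (τ + 1) (t + 1))) := by
  induction t generalizing x with
  | zero =>
    simp [hS.ccdf_snr_one hN hx, Network.rhoCoef, hN.ρ_one, Network.xiBar, expProdCCDF]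
  | succ t ih =>
    have hq : t + 2 ∈ Finset.Icc 2 N.M := Finset.mem_Icc.2 ⟨by omega, by omega⟩
    have hΩ : 0 < N.ρ (t + 2) → 0 < N.harvestFactor (t + 2) := fun h =>
      have := hpos (t + 2) (Finset.mem_Icc.2 ⟨by omega, le_rfl⟩) h
      hN.harvestFactor_pos hq this.1 this.2
    rw [hS.ccdf_snr_succ_succ hN ht hΩ hx, Finset.sum_Icc_succ_top (by omega)]
    congr 1
    · have hterm : ∀ τ ∈ Finset.Icc 1 (t + 1),
          (N.rhoCoef 0 τ * ∏ j ∈ Finset.Icc (τ + 1) (t + 1 + 1), N.rhoCoef 1 j) *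
            expProdCCDF (t + 1 + 1 - τ)
              (x / (N.γ0 * N.meanGain (t + 1 + 2) * N.xiBar (τ + 1) (t + 1 + 1))) =
          N.rhoCoef 1 (t + 2) *
            ((N.rhoCoef 0 τ * ∏ j ∈ Finset.Icc (τ + 1) (t + 1), N.rhoCoef 1 j) *
            ∫ w in Set.Ioi (0 : ℝ), Real.exp (-w) * expProdCCDF (t + 1 - τ)
              (x / (N.γ0 * N.meanGain (t + 1 + 2) * N.xiBar (τ + 1) (t + 1 + 1)) / w)) := by
        intro τ hτ
        rw [Finset.mem_Icc] at hτ
        rw [Finset.prod_Icc_succ_top (by omega), show t + 1 + 1 - τ = t + 1 - τ + 1 by omega,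
          expProdCCDF]
        ring
      rw [Finset.sum_congr rfl hterm, ← Finset.mul_sum]
      rcases (hN.ρ_mem (t + 2) (Finset.mem_Icc.2 ⟨by omega, by omega⟩)).1.eq_or_lt with h0 | h0
      · simp [Network.rhoCoef, ← h0]
      · congr 1
        have hc : 0 < N.harvestFactor (t + 2) * N.meanGain (t + 3) :=
          mul_pos (hΩ h0) (hN.meanGain_pos (Finset.mem_Icc.2 ⟨by omega, by omega⟩))
        simp only [← integral_const_mul]
        rw [← integral_finsetSum]
        · refine setIntegral_congr_fun measurableSet_Ioi fun w hw => ?_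
          rw [ih (by omega) (fun q hq' => hpos q (Finset.Icc_subset_Icc_right (by omega) hq'))
            (div_pos hx (mul_pos hc hw)), Finset.mul_sum]
          refine Finset.sum_congr rfl fun τ hτ => ?_
          rw [Finset.mem_Icc] at hτ
          -- The mean gain of the former last hop `t + 2` moves into `xiBar`, and that of hop `t +
          -- 3` takes its place.
          have hxi : N.xiBar (τ + 1) (t + 1 + 1) =
              N.xiBar (τ + 1) (t + 1) * (N.harvestFactor (t + 2) * N.meanGain (t + 2)) :=
            Finset.prod_Icc_succ_top (by omega) _
          rw [mul_left_comm, hxi, div_div, div_div]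
          congr 4
          ring
        · intro τ hτ
          rw [Finset.mem_Icc] at hτ
          refine Integrable.const_mul (integrableOn_exp_neg_mul
            ((measurable_expProdCCDF _).comp (by fun_prop)) fun w hw => ?_) _
          refine expProdCCDF_mem_Icc _ (div_nonneg (div_nonneg hx.le (mul_nonneg (mul_nonneg
            hN.γ0_pos.le (hN.meanGain_pos (Finset.mem_Icc.2 ⟨by omega, by omega⟩)).le)
            (hN.xiBar_nonneg (by omega) (by omega)))) hw.le)
    · simp [Network.xiBar, expProdCCDF]

theorem snrCCDF_eq_ccdfClosedForm (hS : IsNetworkModel μ N S) [IsProbabilityMeasure μ]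
    (hN : N.Admissible) {t : ℕ} (ht : t ∈ Finset.Icc 1 (N.M - 1))
    (hpos : ∀ q ∈ Finset.Icc 2 t, 0 < N.ρ q → 0 < N.α q ∧ 0 < N.η q) {x : ℝ} (hx : 0 < x) :
    (N.snrCCDF S μ t x : ℂ) = N.ccdfClosedForm t x := by
  rw [Finset.mem_Icc] at ht
  obtain ⟨t, rfl⟩ : ∃ k, t = k + 1 := ⟨t - 1, by omega⟩
  rw [Network.snrCCDF, if_pos hx, hS.ccdf_snr_eq_sum hN (by omega) hpos hx,
    Finset.sum_Icc_succ_top (by omega), add_comm, Complex.ofReal_add, Network.ccdfClosedForm]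
  congr 1
  · simp [Network.xiBar, expProdCCDF]
  · rw [Complex.ofReal_sum, Nat.add_sub_cancel]
    refine Finset.sum_congr rfl fun τ hτ => ?_
    rw [Finset.mem_Icc] at hτ
    rw [Complex.ofReal_mul]
    -- The G-function is identified only at positive arguments. A nonzero coefficient forces `ρ_j >
    -- 0`, hence `Ω_j > 0`, along the whole run; a zero coefficient makes its value irrelevant.
    by_cases h0 : N.rhoCoef 0 τ * ∏ j ∈ Finset.Icc (τ + 1) (t + 1), N.rhoCoef 1 j = 0
    · rw [h0]
      simp
    · congr 1
      refine (meijerG_eq_expProdCCDF _ (div_pos hx (mul_pos (mul_pos hN.γ0_pos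
        (hN.meanGain_pos (Finset.mem_Icc.2 ⟨by omega, by omega⟩))) ?_))).symm
      refine Finset.prod_pos fun j hj => ?_
      have hne := Finset.prod_ne_zero_iff.1 (right_ne_zero_of_mul h0) j hj
      rw [Finset.mem_Icc] at hj
      have hjM : j ∈ Finset.Icc 2 N.M := Finset.mem_Icc.2 ⟨by omega, by omega⟩
      have hρ : 0 < N.ρ j := lt_of_le_of_ne (hN.ρ_mem j (Finset.mem_Icc.2 ⟨by omega, by omega⟩)).1
        (by simpa [Network.rhoCoef, eq_comm] using hne)
      have := hpos j (Finset.mem_Icc.2 ⟨by omega, by omega⟩) hρ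
      exact mul_pos (hN.harvestFactor_pos hjM this.1 this.2) (hN.meanGain_pos hjM)

end IsNetworkModel

/-! ### From target rate to SNR threshold -/

namespace Network

variable {N : Network}

theorem le_mul_logb_two_iff {e R y : ℝ} (he : 0 < e) (hy : 0 ≤ y) :
    R ≤ e * Real.logb 2 (1 + y) ↔ (2 : ℝ) ^ (R / e) - 1 ≤ y := by
  rw [← div_le_iff₀' he, Real.le_logb_iff_rpow_le one_lt_two (by linarith), sub_le_iff_le_add']

/-- Clearing the denominator gives `T ≤ X (1 - (T+1)(1-p))`. As `T > 0` and `X ≥ 0`, this forces the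
bracket to be positive; otherwise interference caps the SINR below `T` at every SNR. -/
theorem le_div_interference_iff {T p X : ℝ} (hT : 0 < T) (hp : p ≤ 1) (hX : 0 ≤ X) :
    T ≤ p * X / ((1 - p) * X + 1) ↔
      0 < T / (1 - (T + 1) * (1 - p)) ∧ T / (1 - (T + 1) * (1 - p)) ≤ X := by
  have h1 : 0 < (1 - p) * X + 1 := by
    have := mul_nonneg (sub_nonneg.2 hp) hX
    linarith
  rw [le_div_iff₀ h1, div_pos_iff_of_pos_left hT]
  have hiff : T * ((1 - p) * X + 1) ≤ p * X ↔ T ≤ X * (1 - (T + 1) * (1 - p)) := by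
    constructor <;> intro h <;> linarith
  rw [hiff]
  constructor
  · intro h
    have hd : 0 < 1 - (T + 1) * (1 - p) := by
      by_contra hcon
      have := mul_nonpos_of_nonneg_of_nonpos hX (not_lt.1 hcon)
      linarith
    exact ⟨hd, (div_le_iff₀ hd).2 h⟩
  · rintro ⟨hd, h⟩
    exact (div_le_iff₀ hd).1 h

theorem Admissible.α_lt_one (hN : N.Admissible) {t : ℕ} (ht : t ∈ Finset.Icc 1 (N.M - 1)) :
    N.α (t + 1) < 1 := by
  rw [Finset.mem_Icc] at ht
  exact (hN.α_mem (t + 1) (Finset.mem_Icc.2 ⟨by omega, by omega⟩)).2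

theorem Admissible.thresholdDirect_pos (hN : N.Admissible) {t : ℕ}
    (ht : t ∈ Finset.Icc 1 (N.M - 1)) (i : Fin 2) : 0 < N.thresholdDirect t i := by
  have hM : (0 : ℝ) < N.M - 1 := by
    have : (2 : ℝ) ≤ N.M := by exact_mod_cast hN.two_le_M
    linarith
  have hα := hN.α_lt_one ht
  rw [thresholdDirect]
  split_ifs
  · exact sub_pos.2 (Real.one_lt_rpow one_lt_two
      (mul_pos (div_pos hM (sub_pos.2 hα)) hN.RM_pos))
  · exact sub_pos.2 (Real.one_lt_rpow one_lt_two (mul_pos hM hN.RM_pos))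

variable {Ω : Type*} (S : RandomState Ω)

theorem Admissible.effectiveTime_pos (hN : N.Admissible) {t : ℕ}
    (ht : t ∈ Finset.Icc 1 (N.M - 1)) (ω : Ω) : 0 < N.effectiveTime S t ω := by
  have hM : (0 : ℝ) < N.M - 1 := by
    have : (2 : ℝ) ≤ N.M := by exact_mod_cast hN.two_le_M
    linarith
  have hα := hN.α_lt_one ht
  refine div_pos ?_ hM
  by_cases h : S.I (t + 1) ω = 1
  · simp [h, hα]
  · simp [show S.I (t + 1) ω = 0 by omega]

theorem rpow_div_effectiveTime (N : Network) (t : ℕ) (ω : Ω) :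
    (2 : ℝ) ^ (N.RM / N.effectiveTime S t ω) - 1 = N.thresholdDirect t (S.I (t + 1) ω) := by
  rw [thresholdDirect, effectiveTime, div_div_eq_mul_div]
  by_cases h : S.I (t + 1) ω = 1
  · simp only [h, if_true]
    congr 2
    simp
    ring
  · simp [show S.I (t + 1) ω = 0 by omega, mul_comm]

/-- The rate reaches the target iff the SNR reaches the threshold that belongs to the harvesting
indicator and to the presence of Type-II devices, and this threshold is positive. -/
theorem target_le_rate_iff (hN : N.Admissible) {t : ℕ} (ht : t ∈ Finset.Icc 1 (N.M - 1))
    (s : Scheme) (ω : Ω) {j : Fin 2} (hj : j = 1 ↔ 1 ≤ (S.Φ t ω).encard) :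
    N.RM ≤ N.rate S s t ω ↔ 0 < N.threshold t (S.I (t + 1) ω) j ∧
      N.threshold t (S.I (t + 1) ω) j ≤ N.snr S t ω := by
  have hX := hN.snr_nonneg S ht ω
  have hT := hN.thresholdDirect_pos ht (S.I (t + 1) ω)
  have he := hN.effectiveTime_pos S ht ω
  have hn := hN.noise_pos
  have hp : 0 ≤ 1 - N.pM := sub_nonneg.2 hN.pM_mem.2
  have hsnr : N.txPower S t ω * N.gain S (t + 1) ω / N.noise = N.snr S t ω := by
    rw [snr]
    ring
  by_cases h : 1 ≤ (S.Φ t ω).encard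
  · have hsinr : N.pM * N.txPower S t ω * N.gain S (t + 1) ω /
        (N.interferenceShare t s * N.txPower S t ω * N.gain S (t + 1) ω + N.noise) =
        N.pM * N.snr S t ω / ((1 - N.pM) * N.snr S t ω + 1) := by
      rw [interferenceShare_eq hN ht, mul_assoc, mul_assoc, (div_eq_iff hn.ne').1 hsnr,
        ← mul_div_mul_right (N.pM * N.snr S t ω) _ hn.ne']
      ring_nf
    rw [rate, if_pos h, hsinr, le_mul_logb_two_iff he
      (div_nonneg (mul_nonneg hN.pM_mem.1 hX) (by positivity)), rpow_div_effectiveTime,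
      le_div_interference_iff hT hN.pM_mem.2 hX, threshold, if_pos (hj.2 h)]
  · rw [rate, if_neg h, hsnr, le_mul_logb_two_iff he hX, rpow_div_effectiveTime, threshold,
      if_neg (mt hj.1 h)]
    exact (and_iff_right hT).symm

end Network

/-! ### Outage probability by independence -/

namespace IsNetworkModel

variable {Ω : Type*} [mΩ : MeasurableSpace Ω] {μ : Measure Ω} {N : Network} {S : RandomState Ω}

/-- The event says that `j` is the indicator of `Φ_t ≠ ∅`; its probability is the Poisson void
probability of the disc or the complement of it. -/
theorem measureReal_encard (hS : IsNetworkModel μ N S) [IsProbabilityMeasure μ]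
    (hN : N.Admissible) {t : ℕ} (ht : t ∈ Finset.Icc 1 (N.M - 1)) (j : Fin 2) :
    μ.real {ω | j = 1 ↔ 1 ≤ (S.Φ t ω).encard} = N.iotaCoef j t := by
  have hP := hS.hppp t ht
  have hr := (hN.r_pos t ht).le
  have hcov : MeasurableSet (N.coverage t) := Metric.isClosed_closedBall.measurableSet
  have hvol : volume.real (N.coverage t) = Real.pi * N.r t ^ 2 := by
    rw [measureReal_def, Network.coverage, EuclideanSpace.volume_closedBall_fin_two,
      ENNReal.toReal_mul, ENNReal.toReal_pow, ENNReal.toReal_ofReal hr,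
      ENNReal.toReal_ofReal Real.pi_pos.le, mul_comm]
  have h0 : μ.real {ω | (S.Φ t ω).encard = 0} =
      Real.exp (-(N.lam t * Real.pi * N.r t ^ 2)) := by
    have h := hP.law_count _ hcov subset_rfl 0
    simp only [Set.inter_eq_left.2 (hP.subset _), Nat.cast_zero, pow_zero, mul_one,
      Nat.factorial_zero, Nat.cast_one, div_one] at h
    rw [h, hvol, mul_assoc]
  have hm : MeasurableSet {ω | (S.Φ t ω).encard = 0} := by
    have h := hP.measurable_count _ hcov
    simp only [Set.inter_eq_left.2 (hP.subset _)] at h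
    exact h (measurableSet_singleton 0)
  rw [Network.iotaCoef]
  split_ifs with hj
  · rw [← h0, ← probReal_compl_eq_one_sub hm]
    congr 1
    ext ω
    simp [hj, Order.one_le_iff_ne_zero]
  · rw [← h0]
    congr 1
    ext ω
    simp [hj, Order.one_le_iff_ne_zero]

theorem measureReal_target_le_rate (hS : IsNetworkModel μ N S) [IsProbabilityMeasure μ]
    (hN : N.Admissible) {t : ℕ} (ht : t ∈ Finset.Icc 1 (N.M - 1)) (s : Scheme) :
    MeasurableSet {ω | N.RM ≤ N.rate S s t ω} ∧
    μ.real {ω | N.RM ≤ N.rate S s t ω} = ∑ i : Fin 2, ∑ j : Fin 2,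
      N.rhoCoef i (t + 1) * N.iotaCoef j t * N.snrCCDF S μ t (N.threshold t i j) := by
  have ht' := Finset.mem_Icc.1 ht
  have hI : t + 1 ∈ Set.Icc 1 N.M := ⟨by omega, by omega⟩
  set J₁ : Set ((Set.Icc 2 N.M ⊕ Set.Icc 1 N.M) ⊕ Unit) := {.inl (.inr ⟨t + 1, hI⟩)} with hJ₁
  set J₂ : Set ((Set.Icc 2 N.M ⊕ Set.Icc 1 N.M) ⊕ Unit) := {.inr ()} with hJ₂
  set J₃ := pastIndex N.M (t + 1) t with hJ₃
  let A : Fin 2 → Set Ω := fun i => {ω | S.I (t + 1) ω = i}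
  let B : Fin 2 → Set Ω := fun j => {ω | j = 1 ↔ 1 ≤ (S.Φ t ω).encard}
  -- The positivity clause is deterministic. It empties the event at an unreachable threshold, in
  -- agreement with the value `0` of `snrCCDF` there.
  let C : Fin 2 → Fin 2 → Set Ω := fun i j =>
    {ω | 0 < N.threshold t i j ∧ N.threshold t i j ≤ N.snr S t ω}
  have hle := hS.jointSigma_le ht
  have hA : ∀ i, MeasurableSet[S.jointSigma N.M t J₁] (A i) := fun i =>
    measurable_I_jointSigma S (T := t) (J := J₁) hI rfl (measurableSet_singleton i)
  have hB : ∀ j, MeasurableSet[S.jointSigma N.M t J₂] (B j) := fun j =>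
    measurable_encard_jointSigma S (T := t) (J := J₂) rfl
      (MeasurableSet.of_discrete (s := {n : ℕ∞ | j = 1 ↔ 1 ≤ n}))
  have hC : ∀ i j, MeasurableSet[S.jointSigma N.M t J₃] (C i j) := fun i j =>
    MeasurableSet.inter (MeasurableSet.const _)
      (measurable_snr_pastIndex S ht le_rfl le_rfl measurableSet_Ici)
  have hmono : ∀ {J K : Set ((Set.Icc 2 N.M ⊕ Set.Icc 1 N.M) ⊕ Unit)}, J ⊆ K →
      S.jointSigma N.M t J ≤ S.jointSigma N.M t K := fun h => biSup_mono h
  have hBC : ∀ i j, MeasurableSet[S.jointSigma N.M t (J₂ ∪ J₃)] (B j ∩ C i j) := fun i j =>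
    MeasurableSet.inter (hmono Set.subset_union_left _ (hB j))
      (hmono Set.subset_union_right _ (hC i j))
  have hd₂₃ : Disjoint J₂ J₃ := by
    rw [hJ₂, Set.disjoint_singleton_left]
    rintro (⟨q, hq, -⟩ | ⟨q, hq, -⟩) <;> simp at hq
  -- The past of the SNR stops at indicator `t`, so it does not contain index `t + 1`.
  have hd₁ : Disjoint J₁ (J₂ ∪ J₃) := by
    rw [hJ₁, Set.disjoint_singleton_left]
    rintro (h | ⟨q, hq, -⟩ | ⟨q, hq, hle⟩)
    · simp [hJ₂] at h
    · simp at hq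
    · simp only [Sum.inl.injEq, Sum.inr.injEq] at hq
      rw [← hq] at hle
      simp at hle
  have hE : ∀ i j, MeasurableSet (A i ∩ (B j ∩ C i j)) := fun i j =>
    (hle _ _ (hA i)).inter (hle _ _ (hBC i j))
  have hunion : {ω | N.RM ≤ N.rate S s t ω} =
      ⋃ p : Fin 2 × Fin 2, A p.1 ∩ (B p.2 ∩ C p.1 p.2) := by
    ext ω
    simp only [Set.mem_iUnion]
    constructor
    · intro h
      obtain ⟨j, hj⟩ : ∃ j : Fin 2, j = 1 ↔ 1 ≤ (S.Φ t ω).encard := by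
        by_cases h : 1 ≤ (S.Φ t ω).encard
        · exact ⟨1, by simp [h]⟩
        · exact ⟨0, by simp [h]⟩
      exact ⟨(S.I (t + 1) ω, j), rfl, hj, (Network.target_le_rate_iff S hN ht s ω hj).1 h⟩
    · rintro ⟨⟨i, j⟩, hi, hj, hc⟩
      obtain rfl : S.I (t + 1) ω = i := hi
      exact (Network.target_le_rate_iff S hN ht s ω hj).2 hc
  have hpair : Pairwise (Function.onFun Disjoint
      fun p : Fin 2 × Fin 2 => A p.1 ∩ (B p.2 ∩ C p.1 p.2)) := by
    rintro ⟨i, j⟩ ⟨i', j'⟩ hne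
    refine Set.disjoint_left.2 ?_
    rintro ω ⟨hi, hj, -⟩ ⟨hi', hj', -⟩
    refine hne ?_
    have h1 : i = i' := (show S.I (t + 1) ω = i from hi).symm.trans hi'
    have h2 : j = 1 ↔ j' = 1 := Iff.trans hj (Iff.symm hj')
    rw [Prod.mk.injEq]
    exact ⟨h1, by omega⟩
  rw [hunion]
  refine ⟨MeasurableSet.iUnion fun p => hE p.1 p.2, ?_⟩
  rw [measureReal_iUnion_fintype hpair fun p => hE p.1 p.2, Fintype.sum_prod_type]
  refine Finset.sum_congr rfl fun i _ => Finset.sum_congr rfl fun j _ => ?_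
  have hCr : μ.real (C i j) = N.snrCCDF S μ t (N.threshold t i j) := by
    rw [Network.snrCCDF]
    split_ifs with h <;> simp [C, h]
  rw [hS.measureReal_inter ht hd₁ (hA i) (hBC i j),
    hS.measureReal_inter ht hd₂₃ (hB j) (hC i j), hCr, ← mul_assoc]
  congr 2
  · exact hS.measureReal_I (Finset.mem_Icc.2 hI) i
  · exact hS.measureReal_encard hN ht j

theorem outageProb_eq (hS : IsNetworkModel μ N S) [IsProbabilityMeasure μ]
    (hN : N.Admissible) {t : ℕ} (ht : t ∈ Finset.Icc 1 (N.M - 1)) (s : Scheme) :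
    N.outageProb S μ s t = 1 - ∑ i : Fin 2, ∑ j : Fin 2,
      N.rhoCoef i (t + 1) * N.iotaCoef j t * N.snrCCDF S μ t (N.threshold t i j) := by
  obtain ⟨hm, h⟩ := hS.measureReal_target_le_rate hN ht s
  rw [← h, ← probReal_compl_eq_one_sub hm, Network.outageProb]
  congr 1
  ext ω
  simp

end IsNetworkModel

end

theorem theorem1 {Ω : Type*} [MeasurableSpace Ω] (μ : Measure Ω) [IsProbabilityMeasure μ]
    (N : Network) (hN : N.Admissible) (S : RandomState Ω) (hS : IsNetworkModel μ N S)
    (t : ℕ) (ht : t ∈ Finset.Icc 1 (N.M - 1)) :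
    N.outageProb S μ Scheme.TQoM t = N.outageProb S μ Scheme.TCoM t ∧
    N.outageProb S μ Scheme.TQoM t =
      1 - ∑ i : Fin 2, ∑ j : Fin 2,
        N.rhoCoef i (t + 1) * N.iotaCoef j t * N.snrCCDF S μ t (N.threshold t i j) ∧
    ((∀ q ∈ Finset.Icc 2 t, 0 < N.ρ q → 0 < N.α q ∧ 0 < N.η q) →
      ∀ x : ℝ, 0 < x → (N.snrCCDF S μ t x : ℂ) = N.ccdfClosedForm t x) :=
  ⟨(hS.outageProb_eq hN ht _).trans (hS.outageProb_eq hN ht _).symm, hS.outageProb_eq hN ht _,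
    fun hpos _ hx => hS.snrCCDF_eq_ccdfClosedForm hN ht hpos hx⟩
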